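/- Let $m\ge 0$, let $X_1,\dots,X_m$ be path-connected topological spaces with base-points $x_i\in X_i$ (written $*$), and let $K$ be an abstract simplicial complex on the vertex set $[m]=\{1,\dots,m\}$, always containing the empty simplex (not every $i\in[m]$ is required to be a vertex of a simplex). For subspaces $A_i\subset Y_i$ let $$Z(K;(\underline{Y},\underline{A}))=\bigcup_{\sigma\in K}\{y\in Y_1\times\dots\times Y_m : y_i\in A_i \text{ for all } i\notin\sigma\}\subset Y_1\times\dots\times Y_m,$$ with the subspace topology. Let $PX_i$ be the space of continuous maps $f:[0,1]\to X_i$ with $f(0)=x_i$ (compact-open topology) and $\Omega X_i\subset PX_i$ the subspace of those $f$ with $f(1)=x_i$. For a continuous map $g:Z\to B$ and $b\in B$, the homotopy fibre of $g$ over $b$ is the space of pairs $(z,\delta)$ with $z\in Z$ and $\delta:[0,1]\to B$ continuous, $\delta(0)=b$, $\delta(1)=g(z)$. (1) For every $b\in\prod_i X_i$, the homotopy fibre over $b$ of the inclusion $Z(K;(\underline{X},\underline{*}))\subset Z(K;(\underline{X},\underline{X}))=\prod_i X_i$ is homotopy equivalent to $Z(K;(\underline{PX},\underline{\Omega X}))$,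 by a homotopy equivalence $e$ from $Z(K;(\underline{PX},\underline{\Omega X}))$ to the homotopy fibre whose composite with the projection $(z,\delta)\mapsto z$ is the map $(f_1,\dots,f_m)\mapsto(f_1(1),\dots,f_m(1))$. (2) For $j\ge 0$ let $W_j(\prod X_i)$ be the subspace of those $y\in\prod_i X_i$ with $y_i=x_i$ for at least $m-j$ values of $i$, and let $\Delta[m-1]_{j-1}$ be the simplicial complex of all subsets of $[m]$ of cardinality at most $j$. Then $W_j(\prod X_i)=Z(\Delta[m-1]_{j-1};(\underline{X},\underline{*}))$, and for every $b\in\prod_i X_i$ the homotopy fibre over $b$ of the inclusion $W_j(\prod X_i)\subset\prod_i X_i$ is homotopy equivalent to $Z(\Delta[m-1]_{j-1};(\underline{PX},\underline{\Omega X}))$, by a homotopy equivalence with the same compatibility as in (1). -/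

import Mathlib

open scoped ContinuousMap

universe u v

namespace Polyhedral

/-! ### Polyhedral products

Mathlib's `PreAbstractSimplicialComplex (Fin m)` is a family of nonempty finite subsets of the vertex
set, closed under passing to nonempty subsets.  In the present convention the empty simplex always
belongs to a simplicial complex, so it is added in `IsSimplex`. -/

/-- `σ` is a simplex of `K`; the empty simplex always is one. -/
def IsSimplex {m : ℕ} (K : PreAbstractSimplicialComplex (Fin m)) (σ : Finset (Fin m)) : Prop :=
  σ = ∅ ∨ σ ∈ K.faces

/-- `D(σ) = ∏ Yᵢ` with `Yᵢ = Xᵢ` for `i ∈ σ` and `Yᵢ = Aᵢ` for `i ∉ σ`. -/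
def simplexProduct {m : ℕ} {X : Fin m → Type u} (A : ∀ i, Set (X i)) (σ : Finset (Fin m)) :
    Set (∀ i, X i) :=
  {y | ∀ i, i ∉ σ → y i ∈ A i}

/-- The polyhedral product `Z(K; (X, A)) = ⋃_{σ ∈ K} D(σ)`, a subspace of `∏ Xᵢ`. -/
def polyhedralProduct {m : ℕ} (K : PreAbstractSimplicialComplex (Fin m)) {X : Fin m → Type u}
    (A : ∀ i, Set (X i)) : Set (∀ i, X i) :=
  ⋃ σ ∈ {σ | IsSimplex K σ}, simplexProduct A σ

theorem mem_polyhedralProduct {m : ℕ} {K : PreAbstractSimplicialComplex (Fin m)}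
    {X : Fin m → Type u} {A : ∀ i, Set (X i)} {y : ∀ i, X i} :
    y ∈ polyhedralProduct K A ↔ ∃ σ, IsSimplex K σ ∧ ∀ i, i ∉ σ → y i ∈ A i := by
  simp [polyhedralProduct, simplexProduct]

/-- `Z(K; (X, X))` is the whole product `∏ Xᵢ`. -/
theorem polyhedralProduct_univ {m : ℕ} (K : PreAbstractSimplicialComplex (Fin m))
    (X : Fin m → Type u) :
    polyhedralProduct K (fun i => (Set.univ : Set (X i))) = Set.univ :=
  Set.eq_univ_of_forall fun _ =>
    mem_polyhedralProduct.2 ⟨∅, Or.inl rfl, fun _ _ => Set.mem_univ _⟩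

/-- For closed `Aᵢ` the subspace topology of `Z(K; (X, A))` is the colimit topology
determined by the subspaces `D(σ)`. -/
theorem isCoherentWith_simplexProduct {m : ℕ} (K : PreAbstractSimplicialComplex (Fin m))
    {X : Fin m → Type u} [∀ i, TopologicalSpace (X i)] (A : ∀ i, Set (X i))
    (hA : ∀ i, IsClosed (A i)) :
    Topology.IsCoherentWith (X := polyhedralProduct K A)
      ((fun σ => Subtype.val ⁻¹' simplexProduct A σ) '' {σ | IsSimplex K σ}) := by
  refine Topology.IsCoherentWith.of_isClosed fun t ht => ?_
  have hD : ∀ σ, IsClosed (simplexProduct A σ) := fun σ => by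
    simp only [simplexProduct, Set.ofPred_forall]
    exact isClosed_iInter fun i => isClosed_iInter fun _ =>
      (hA i).preimage (continuous_apply i)
  have key : t = ⋃ σ ∈ {σ | IsSimplex K σ},
      (Subtype.val ⁻¹' simplexProduct A σ : Set (polyhedralProduct K A)) ∩ t := by
    ext z
    have hz := mem_polyhedralProduct.1 z.2
    simp only [Set.mem_iUnion, Set.mem_inter_iff, Set.mem_preimage]
    exact ⟨fun h => by obtain ⟨σ, h1, h2⟩ := hz; exact ⟨σ, h1, h2, h⟩,
      fun ⟨_, _, _, h⟩ => h⟩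
  rw [key]
  refine (Set.toFinite _).isClosed_biUnion fun σ hσ => ?_
  have hc : IsClosed (Subtype.val ⁻¹' simplexProduct A σ : Set (polyhedralProduct K A)) :=
    (hD σ).preimage continuous_subtype_val
  have h1 := hc.isClosedMap_subtype_val _ (ht _ ⟨σ, hσ, rfl⟩)
  rwa [Subtype.image_preimage_coe] at h1

/-- `Δ[m-1]_q`, the `q`-skeleton of the simplex with `m` vertices: its simplices are the subsets of
the vertex set of cardinality at most `q + 1` (for `q = -1` only the empty simplex). -/
def simplexSkeleton (m : ℕ) (q : ℤ) : PreAbstractSimplicialComplex (Fin m) where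
  faces := {σ | σ.Nonempty ∧ (σ.card : ℤ) ≤ q + 1}
  isRelLowerSet_faces := fun _ hσ => ⟨hσ.1, fun _ hτ hne =>
    ⟨hne, le_trans (by exact_mod_cast Finset.card_le_card hτ) hσ.2⟩⟩

/-- The `j`-th filtration `W_j(∏ Xᵢ)` of the product: the points `y` with `yᵢ` equal to the
base-point `xᵢ` for at least `m - j` values of `i`. -/
def fatWedge {m : ℕ} {X : Fin m → Type u} (x : ∀ i, X i) (j : ℕ) : Set (∀ i, X i) :=
  {y | m - j ≤ {i | y i = x i}.ncard}

/-! ### Path spaces, loop spaces, homotopy fibres -/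

/-- The space `PX` of continuous maps `f : [0,1] → X` with `f 0 = x`, with the compact-open
topology. -/
abbrev PathsFrom (X : Type u) [TopologicalSpace X] (x : X) : Type u :=
  {f : C(unitInterval, X) // f 0 = x}

/-- The subspace `ΩX` of `PX`: the paths from `x` that end at `x`. -/
def loops (X : Type u) [TopologicalSpace X] (x : X) : Set (PathsFrom X x) :=
  {f | f.1 1 = x}

/-- The (standard) homotopy fibre of `f : Z → B` over `b`: pairs of a point `z` of `Z` and a path
in `B` from `b` to `f z`. -/
abbrev HomotopyFibre {Z : Type u} {B : Type v} [TopologicalSpace Z] [TopologicalSpace B]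
    (f : C(Z, B)) (b : B) : Type (max u v) :=
  {p : Z × C(unitInterval, B) // p.2 0 = b ∧ p.2 1 = f p.1}

/-- The inclusion of a subspace. -/
def inclusion {B : Type u} [TopologicalSpace B] (s : Set B) : C(s, B) :=
  ⟨Subtype.val, continuous_subtype_val⟩

end Polyhedral

/-!
A tuple of based paths `γ` lies in `Z(K; (PX, ΩX))` exactly when its tuple of end points lies in
`Z(K; (X, *))`, since `γᵢ ∈ ΩXᵢ` means `γᵢ 1 = xᵢ`.  As a path in `∏ Xᵢ` is the same as a tuple of
paths, `Z(K; (PX, ΩX))` is therefore *homeomorphic* to the homotopy fibre of the inclusion over the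
base-point `x` (`polyhedralPathsHomeomorph`).

Over an arbitrary `b`, path-connectedness supplies a path `c` from `x` to `b`, and homotopy fibres
over the two ends of a path are homotopy equivalent over `Z` (`HomotopyFibre.slideEquiv`).  To see
the latter, let `Tₛₜ` carry the fibre over `c s` to the fibre over `c t` by running along `c` from
`c t` back to `c s` before following the given path.  The parametrization allots time proportional
to `|t - s|` to the first piece, so that `Tₛₛ` is the identity on the nose and `Tₛₜ` is continuous
in `s` and `t` together.  The maps `Tᵣₛ ∘ Tₛᵣ`, as `r` moves from `t` to `s`, are then a homotopy
from `Tₜₛ ∘ Tₛₜ` to the identity.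

The filtration statement is the case of a skeleton of the simplex, once `fatWedge` is recognized as
a polyhedral product.
-/

namespace Polyhedral

/-- The path that runs along `c` from `c t` to `c s` at unit speed and then follows `δ`, rescaled
from `[0, 1 + |t - s|]` to the unit interval.  The argument of `c` at time `v ≤ |t - s|` is the
point of the segment between `t` and `s` at distance `v` from `t`, whichever end is larger. -/
noncomputable def slideFun {B : Type v} [TopologicalSpace B] (c : C(unitInterval, B))
    (s t : unitInterval) (δ : C(unitInterval, B)) (u : unitInterval) : B :=
  if (u : ℝ) * (1 + |(t : ℝ) - s|) ≤ |(t : ℝ) - s| then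
    c (Set.projIcc 0 1 zero_le_one (s + max 0 ((t : ℝ) - s - u * (1 + |(t : ℝ) - s|))
      - max 0 ((s : ℝ) - t - u * (1 + |(t : ℝ) - s|))))
  else δ (Set.projIcc 0 1 zero_le_one (u * (1 + |(t : ℝ) - s|) - |(t : ℝ) - s|))

section slideFun

variable {B : Type v} [TopologicalSpace B] (c : C(unitInterval, B))

/-- Joint continuity in all arguments.  The two pieces agree at the time `|t - s|` because `δ`
starts at `c s`. -/
theorem continuous_slideFun {Y : Type*} [TopologicalSpace Y] {s t u : Y → unitInterval}
    {δ : Y → C(unitInterval, B)} (hs : Continuous s) (ht : Continuous t) (hδ : Continuous δ)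
    (hu : Continuous u) (h0 : ∀ y, δ y 0 = c (s y)) :
    Continuous fun y => slideFun c (s y) (t y) (δ y) (u y) := by
  unfold slideFun
  refine Continuous.if_le ?_ ?_ (by fun_prop) (by fun_prop) fun y hy => ?_
  · exact c.continuous.comp (continuous_projIcc.comp (by fun_prop))
  · exact hδ.eval (continuous_projIcc.comp (by fun_prop))
  · rw [hy, sub_self, max_eq_left (sub_nonpos.2 (le_abs_self _)), max_eq_left, add_zero, sub_zero,
      Set.projIcc_val, Set.projIcc_left]
    · exact (h0 y).symm
    · rw [abs_sub_comm]
      exact sub_nonpos.2 (le_abs_self _)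

theorem slideFun_zero (s t : unitInterval) (δ : C(unitInterval, B)) :
    slideFun c s t δ 0 = c t := by
  have h : (s : ℝ) + max 0 ((t : ℝ) - s) - max 0 ((s : ℝ) - t) = t := by
    rcases le_total (s : ℝ) t with h | h
    · rw [max_eq_right (sub_nonneg.2 h), max_eq_left (sub_nonpos.2 h)]; ring
    · rw [max_eq_left (sub_nonpos.2 h), max_eq_right (sub_nonneg.2 h)]; ring
  simp [slideFun, h]

theorem slideFun_one (s t : unitInterval) (δ : C(unitInterval, B)) :
    slideFun c s t δ 1 = δ 1 := by
  simp [slideFun]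

theorem slideFun_self (s : unitInterval) (δ : C(unitInterval, B)) (h0 : δ 0 = c s)
    (u : unitInterval) : slideFun c s s δ u = δ u := by
  rcases eq_or_ne u 0 with rfl | hu
  · rw [slideFun_zero, h0]
  · have hu' : ¬ (u : ℝ) ≤ 0 := not_le.2 (unitInterval.pos_iff_ne_zero.2 hu)
    simp [slideFun, hu']

end slideFun

namespace HomotopyFibre

variable {Z : Type u} {B : Type v} [TopologicalSpace Z] [TopologicalSpace B] {f : C(Z, B)}
  (c : C(unitInterval, B))

/-- Transport of the homotopy fibre over `c s` to the one over `c t` along `c`. -/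
noncomputable def slide (s t : unitInterval) (p : HomotopyFibre f (c s)) :
    HomotopyFibre f (c t) :=
  ⟨(p.1.1, ⟨slideFun c s t p.1.2, continuous_slideFun c continuous_const continuous_const
    continuous_const continuous_id fun _ => p.2.1⟩),
    slideFun_zero c s t _, (slideFun_one c s t _).trans p.2.2⟩

theorem slide_self (s : unitInterval) (p : HomotopyFibre f (c s)) : slide c s s p = p :=
  Subtype.ext (Prod.ext rfl (ContinuousMap.ext (slideFun_self c s p.1.2 p.2.1)))

theorem continuous_slide (s t : unitInterval) :
    Continuous (slide c s t : HomotopyFibre f (c s) → HomotopyFibre f (c t)) := by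
  refine Continuous.subtype_mk (Continuous.prodMk (by fun_prop) ?_) _
  refine ContinuousMap.continuous_of_continuous_uncurry _ ?_
  exact continuous_slideFun c continuous_const continuous_const (by fun_prop) continuous_snd
    fun y => y.1.2.1

/-- Going to the fibre over `c r` and back is continuous in `r`. -/
theorem continuous_slide_slide (s : unitInterval) :
    Continuous fun q : unitInterval × HomotopyFibre f (c s) =>
      slide c q.1 s (slide c s q.1 q.2) := by
  refine Continuous.subtype_mk (Continuous.prodMk (by fun_prop) ?_) _
  refine ContinuousMap.continuous_of_continuous_uncurry _ ?_
  refine continuous_slideFun c (by fun_prop) continuous_const ?_ continuous_snd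
    fun y => (slide c s y.1.1 y.1.2).2.1
  refine ContinuousMap.continuous_of_continuous_uncurry _ ?_
  exact continuous_slideFun c continuous_const (by fun_prop) (by fun_prop) continuous_snd
    fun y => y.1.1.2.2.1

theorem slide_slide_homotopic (s t : unitInterval) :
    ContinuousMap.Homotopic
      ((⟨slide c t s, continuous_slide c t s⟩ :
          C(HomotopyFibre f (c t), HomotopyFibre f (c s))).comp
        ⟨slide c s t, continuous_slide c s t⟩)
      (ContinuousMap.id _) := by
  have : PathConnectedSpace unitInterval := isPathConnected_iff_pathConnectedSpace.1
    ((convex_Icc (0 : ℝ) 1).isPathConnected (Set.nonempty_Icc.2 zero_le_one))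
  let r : Path t s := PathConnectedSpace.somePath t s
  exact ⟨{
    toFun := fun q => slide c (r q.1) s (slide c s (r q.1) q.2)
    continuous_toFun := (continuous_slide_slide c s).comp
      (f := fun q : unitInterval × HomotopyFibre f (c s) => (r q.1, q.2)) (by fun_prop)
    map_zero_left := fun p => by rw [r.source]; rfl
    map_one_left := fun p => by rw [r.target, slide_self, slide_self]; rfl }⟩

/-- Homotopy fibres over two points of a path are homotopy equivalent, compatibly with the
projections to `Z`. -/
noncomputable def slideEquiv (s t : unitInterval) :
    HomotopyFibre f (c s) ≃ₕ HomotopyFibre f (c t) where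
  toFun := ⟨slide c s t, continuous_slide c s t⟩
  invFun := ⟨slide c t s, continuous_slide c t s⟩
  left_inv := slide_slide_homotopic c s t
  right_inv := slide_slide_homotopic c t s

end HomotopyFibre

section PolyhedralPaths

variable {m : ℕ} {X : Fin m → Type u} [∀ i, TopologicalSpace (X i)] (x : ∀ i, X i)

theorem mem_polyhedralProduct_loops_iff (K : PreAbstractSimplicialComplex (Fin m))
    (γ : ∀ i, PathsFrom (X i) (x i)) :
    γ ∈ polyhedralProduct K (fun i => loops (X i) (x i)) ↔
      (fun i => (γ i).1 1) ∈ polyhedralProduct K (fun i => ({x i} : Set (X i))) := by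
  simp only [mem_polyhedralProduct]
  rfl

/-- `Z(K; (PX, ΩX))` is homeomorphic to the homotopy fibre over the base-point of the inclusion of
`Z(K; (X, *))` in the product. -/
def polyhedralPathsHomeomorph (K : PreAbstractSimplicialComplex (Fin m)) :
    polyhedralProduct K (fun i => loops (X i) (x i)) ≃ₜ
      HomotopyFibre (inclusion (polyhedralProduct K (fun i => ({x i} : Set (X i))))) x where
  toFun γ := ⟨(⟨fun i => (γ.1 i).1 1, (mem_polyhedralProduct_loops_iff x K γ.1).1 γ.2⟩,
    ContinuousMap.pi fun i => (γ.1 i).1), funext fun i => (γ.1 i).2, rfl⟩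
  invFun p := ⟨fun i => ⟨(ContinuousMap.eval i).comp p.1.2, congrFun p.2.1 i⟩,
    (mem_polyhedralProduct_loops_iff x K _).2 (Set.mem_of_eq_of_mem p.2.2 p.1.1.2)⟩
  left_inv _ := rfl
  right_inv p := Subtype.ext (Prod.ext (Subtype.ext p.2.2) rfl)
  continuous_toFun := by
    refine Continuous.subtype_mk (Continuous.prodMk ?_ ?_) _
    · refine Continuous.subtype_mk (continuous_pi fun i => ?_) _
      exact (continuous_eval_const (F := C(unitInterval, X i)) 1).comp (continuous_subtype_val.comp
        ((continuous_apply i).comp continuous_subtype_val))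
    · refine ContinuousMap.continuous_of_continuous_uncurry _ (continuous_pi fun i => ?_)
      change Continuous fun q : polyhedralProduct K (fun i => loops (X i) (x i)) × unitInterval =>
        (q.1.1 i).1 q.2
      exact (continuous_subtype_val.comp ((continuous_apply i).comp
        (continuous_subtype_val.comp continuous_fst))).eval continuous_snd
  continuous_invFun := by
    refine Continuous.subtype_mk (continuous_pi fun i => Continuous.subtype_mk ?_ _) _
    exact (ContinuousMap.continuous_postcomp _).comp (by fun_prop)

theorem exists_polyhedralPaths_homotopyEquiv [∀ i, PathConnectedSpace (X i)]
    (K : PreAbstractSimplicialComplex (Fin m)) (b : ∀ i, X i) :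
    ∃ e : polyhedralProduct K (fun i => loops (X i) (x i)) ≃ₕ
        HomotopyFibre (inclusion (polyhedralProduct K (fun i => ({x i} : Set (X i))))) b,
      ∀ γ, ((e γ).1.1 : ∀ i, X i) = fun i => (γ.1 i).1 1 := by
  obtain ⟨c, rfl, rfl⟩ : ∃ c : C(unitInterval, ∀ i, X i), c 0 = x ∧ c 1 = b :=
    let p : Path x b := Path.pi fun i => PathConnectedSpace.somePath (x i) (b i)
    ⟨p, p.source, p.target⟩
  exact ⟨(polyhedralPathsHomeomorph (c 0) K).toHomotopyEquiv.trans
    (HomotopyFibre.slideEquiv c 0 1), fun _ => rfl⟩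

end PolyhedralPaths

theorem fatWedge_eq_polyhedralProduct {m : ℕ} {X : Fin m → Type u} (x : ∀ i, X i) (j : ℕ) :
    fatWedge x j =
      polyhedralProduct (simplexSkeleton m ((j : ℤ) - 1)) (fun i => ({x i} : Set (X i))) := by
  classical
  ext y
  have hcard : {i | y i = x i}.ncard = (Finset.univ.filter fun i => y i = x i).card := by
    rw [← Set.ncard_coe_finset]
    simp
  have hsum := Finset.card_filter_add_card_filter_not (s := Finset.univ) (fun i => y i = x i)
  rw [Finset.card_univ, Fintype.card_fin] at hsum
  rw [mem_polyhedralProduct, fatWedge, Set.mem_ofPred_eq, hcard]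
  constructor
  · intro h
    refine ⟨Finset.univ.filter fun i => ¬ y i = x i, ?_, fun i hi => by simpa using hi⟩
    refine (Finset.eq_empty_or_nonempty _).imp_right fun hne => ⟨hne, ?_⟩
    omega
  · rintro ⟨σ, hσ, hy⟩
    have hle : (Finset.univ.filter fun i => ¬ y i = x i).card ≤ σ.card :=
      Finset.card_le_card fun i hi => by
        by_contra hiσ
        exact (Finset.mem_filter.1 hi).2 (hy i hiσ)
    have hσj : σ.card ≤ j := by
      rcases hσ with rfl | ⟨-, h⟩
      · simp
      · omega
    omega

end Polyhedral

open Polyhedral in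
theorem mainTheorem12 {m : ℕ} (X : Fin m → Type u) [∀ i, TopologicalSpace (X i)]
    [∀ i, PathConnectedSpace (X i)] (x : ∀ i, X i) :
    (∀ (K : PreAbstractSimplicialComplex (Fin m)) (b : ∀ i, X i),
      ∃ e : polyhedralProduct K (fun i => loops (X i) (x i)) ≃ₕ
          HomotopyFibre (inclusion (polyhedralProduct K (fun i => ({x i} : Set (X i))))) b,
        ∀ γ, ((e γ).1.1 : ∀ i, X i) = fun i => (γ.1 i).1 1) ∧
    (∀ j : ℕ,
      fatWedge x j =
        polyhedralProduct (simplexSkeleton m ((j : ℤ) - 1)) (fun i => ({x i} : Set (X i))) ∧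
      ∀ b : ∀ i, X i,
        ∃ e : polyhedralProduct (simplexSkeleton m ((j : ℤ) - 1))
            (fun i => loops (X i) (x i)) ≃ₕ HomotopyFibre (inclusion (fatWedge x j)) b,
          ∀ γ, ((e γ).1.1 : ∀ i, X i) = fun i => (γ.1 i).1 1) := by
  refine ⟨exists_polyhedralPaths_homotopyEquiv x, fun j => ?_⟩
  have h := fatWedge_eq_polyhedralProduct x j
  refine ⟨h, fun b => ?_⟩
  rw [h]
  exact exists_polyhedralPaths_homotopyEquiv x _ b
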